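/- All digraphs are finite, nonempty, and have no loops and no multiple arcs (a pair of opposite arcs $uv$, $vu$ is allowed). A digraph $D$ is *$l$-strong* if it has at least $l+1$ vertices and, after deleting any set of at most $l-1$ vertices, for any two distinct remaining vertices $x,y$ there is a directed path from $x$ to $y$. A digraph $D$ is *$k$-linked* if for any $2k$ distinct vertices $x_1,\dots,x_k,y_1,\dots,y_k$ of $D$ there are pairwise vertex-disjoint directed paths $P_1,\dots,P_k$ such that $P_i$ starts at $x_i$ and ends at $y_i$ for each $i$. A digraph is *semicomplete* if there is at least one arc between any two distinct vertices. For a digraph $R$ with vertices $v_1,\dots,v_r$, $r\ge 2$, and pairwise disjoint digraphs $S_1,\dots,S_r$, the *composition* $R[S_1,\dots,S_r]$ has vertex set $V(S_1)\cup\dots\cup V(S_r)$ and arc set $\bigcup_i A(S_i)\cup\{st : s\in V(S_i),\ t\in V(S_j),\ v_iv_j\in A(R)\}$; it is a *semicomplete composition* if $R$ is semicomplete. **Proposition.** Let $k\ge 3$ and $l\ge 0$ be integers. There exist an integer $r\ge 2$, a semicomplete digraph $R$ on $r$ vertices and disjoint digraphs $S_1,\dots,S_r$ such that the semicomplete composition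 $D=R[S_1,\dots,S_r]$ satisfies $|V(D)\setminus V(S_r)|\le 2k-4$, is $l$-strong, and is not $k$-linked. -/

import Mathlib

namespace Digraph

/-- A digraph without loops. (Mathlib's `Digraph` has no multiple arcs, but may have loops;
opposite arcs between two vertices are allowed.) -/
def IsLoopless {V : Type*} (D : Digraph V) : Prop :=
  ∀ v, ¬ D.Adj v v

/-- There is at least one arc between any two distinct vertices. -/
def IsSemicomplete {V : Type*} (D : Digraph V) : Prop :=
  ∀ u v, u ≠ v → D.Adj u v ∨ D.Adj v u

/-- `p` is the list of vertices, in order, of a directed `(x, y)`-path of `D`. -/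
def IsDiPath {V : Type*} (D : Digraph V) (x y : V) (p : List V) : Prop :=
  p.IsChain D.Adj ∧ p.Nodup ∧ p.head? = some x ∧ p.getLast? = some y

/-- `D` is `l`-strong: it has at least `l + 1` vertices and, after deleting any set `X` of at most
`l - 1` vertices, there is a path from `x` to `y` for any two distinct remaining vertices. -/
def IsKStrong {V : Type*} (D : Digraph V) (l : ℕ) : Prop :=
  l + 1 ≤ Nat.card V ∧
    ∀ X : Finset V, X.card < l → ∀ x y : V, x ∉ X → y ∉ X → x ≠ y →
      ∃ p : List V, D.IsDiPath x y p ∧ ∀ z ∈ p, z ∉ X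

/-- `D` is `k`-linked: for any `2 * k` distinct vertices `x i`, `y i` there are pairwise
vertex-disjoint paths, the `i`-th one from `x i` to `y i`. -/
def IsKLinked {V : Type*} (D : Digraph V) (k : ℕ) : Prop :=
  ∀ x y : Fin k → V, Function.Injective (Sum.elim x y) →
    ∃ P : Fin k → List V, (∀ i, D.IsDiPath (x i) (y i) (P i)) ∧
      ∀ i j, i ≠ j → List.Disjoint (P i) (P j)

/-- The composition `R[S_i : i ∈ ι]`: the disjoint union of the digraphs `S i`, together with all
arcs from the part `S i` to the part `S j` whenever `i j` is an arc of `R`. -/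
def composition {ι : Type*} (R : Digraph ι) {V : ι → Type*} (S : ∀ i, Digraph (V i)) :
    Digraph (Σ i, V i) where
  Adj a b := (∃ i u v, a = ⟨i, u⟩ ∧ b = ⟨i, v⟩ ∧ (S i).Adj u v) ∨ R.Adj a.1 b.1

end Digraph

/-! Take `R` complete on two vertices, `S_1` arcless on `2k - 4` vertices and `S_2` an `l`-strong
digraph with two terminal pairs not joined by disjoint paths. Let the other `k - 2` pairs use up all
of `S_1`. In any linkage the first two paths are then confined to `S_2`, which is impossible; the
join inherits `l`-strength from `S_2` (`join_isKStrong`).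

The second part is `unlinked m`. Its left half is a planar strip of levels `0, …, m`, each a lane
running rightwards, with a `2m`-fold refinement from level to level; hop arcs lead from the leaves
back to the left ends. The right half is the reversed copy, and the two are joined at the right ends
of equal levels.

A path from `s false` to `t false` contains a forward path from the upper boundary of the left half
to the exit of some level `a`, followed by a walk in the right half to level zero
(`passesFromUpper_of_path`). Dually, a path from `s true` to `t true` crosses at a level `a'`,
coming from level zero. By planarity the walk from level zero stays below the forward path, so
disjointness forces `a' < a` on the left and `a < a'` on the right (`level_lt_of_disjoint`).

For connectivity, fewer than `m` deletions leave one level intact in both halves. Branching and hops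
lead every vertex to its left end, its lanes cross to the right half, and reversal gives the way to
every vertex (`reach_of_alive`). -/

namespace Digraph

/-! ### Planar strips: a walk below a path stays below it -/

/-- A relation `F` drawn in the plane: the vertex `v` has abscissa `x v` and height `ℓ v`, all arcs
go to the right and change the height by at most one, and they do not cross. -/
structure IsStrip {α : Type*} (x ℓ : α → ℕ) (F : α → α → Prop) : Prop where
  lt : ∀ u w, F u w → x u < x w
  le_succ : ∀ u w, F u w → ℓ w ≤ ℓ u + 1
  succ_ge : ∀ u w, F u w → ℓ u ≤ ℓ w + 1
  ne_min : ∀ u w z, F u w → x u < x z → x z < x w → ℓ z ≠ min (ℓ u) (ℓ w)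
  descend : ∀ u w z q, F u w → ℓ u = ℓ w + 1 → x u < x z → x z < x w → ℓ z = ℓ u → F q z →
    ℓ z ≤ ℓ q

/-- No arc passes above `z`. -/
def IsTopOf {α : Type*} (x ℓ : α → ℕ) (F : α → α → Prop) (z : α) : Prop :=
  ∀ u w, F u w → x u < x z → x z < x w → min (ℓ u) (ℓ w) < ℓ z

/-- `q` lies below every arc of `p 0, …, p c` that passes over or under it. -/
def Below {α : Type*} (x ℓ : α → ℕ) (p : ℕ → α) (c : ℕ) (q : α) : Prop :=
  ∀ i < c, x (p i) < x q → x q < x (p (i + 1)) → ℓ q < min (ℓ (p i)) (ℓ (p (i + 1)))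

namespace IsStrip

variable {α : Type*} {x ℓ : α → ℕ} {F : α → α → Prop} {p : ℕ → α} {c : ℕ} {q q' : α}

/-- To get above the path, the arc `q q'` would have to cross it or pass over its start. The latter
is excluded because `p 0` is on top, and `key` carries this along: every path vertex over the span
of the arc is higher than the lower end of the arc. -/
theorem below_of_arc (hF : IsStrip x ℓ F) (hp : ∀ i < c, F (p i) (p (i + 1)))
    (h0 : IsTopOf x ℓ F (p 0)) (hqq : F q q') (hq : ∀ i ≤ c, x (p i) ≠ x q)
    (hb : Below x ℓ p c q) : Below x ℓ p c q' := by
  have key : ∀ i ≤ c, x q < x (p i) → x (p i) < x q' → min (ℓ q) (ℓ q') < ℓ (p i) := by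
    intro i
    induction i with
    | zero => intro _ h1 h2; exact h0 _ _ hqq h1 h2
    | succ i ih =>
      intro hi h1 h2
      have hF1 := hp i (by omega)
      have hlt := hF.lt _ _ hF1
      rcases lt_or_ge (x q) (x (p i)) with h3 | h3
      · have := ih (by omega) h3 (by omega)
        have h4 := hF.succ_ge _ _ hF1
        have h5 := hF.ne_min _ _ _ hqq h1 h2
        omega
      · have h4 := hq i (by omega)
        have := hb i (by omega) (by omega) h1
        omega
  intro i hi h1 h2
  have hF1 := hp i hi
  have hne := hF.ne_min _ _ _ hF1 h1 h2
  have hle := hF.le_succ _ _ hqq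
  have hge := hF.succ_ge _ _ hqq
  have hltq := hF.lt _ _ hqq
  by_contra hcon
  rcases lt_or_ge (x q) (x (p i)) with h3 | h3
  · have h4 := key i (by omega) h3 h1
    have h5 := hF.succ_ge _ _ hF1
    have h6 := hF.le_succ _ _ hF1
    -- The inequalities leave one configuration: the path descends by one over `q'`, which has the
    -- height of the upper end and is entered from one level below. This is what `descend` forbids.
    have := hF.descend _ _ q' q hF1 (by omega) h1 h2 (by omega) hqq
    omega
  · have h4 := hq i (by omega)
    have := hb i hi (by omega) (by omega)
    omega

/-- No arc passes over `q`, yet `q` is below every path arc spanning it, so no path arc spans `q`.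
As the path ends to the right of `q`, all of it lies there, and anything left of `q` is below it
vacuously. -/
theorem below_of_hop (hz : IsTopOf x ℓ F q) (hp : ∀ i < c, F (p i) (p (i + 1)))
    (hq : ∀ i ≤ c, x (p i) ≠ x q) (hqc : x q < x (p c)) (hb : Below x ℓ p c q)
    (hlt : x q' < x q) : Below x ℓ p c q' := by
  have key : ∀ d ≤ c, x q < x (p (c - d)) := by
    intro d
    induction d with
    | zero => intro _; simpa using hqc
    | succ d ih =>
      intro hd
      have h1 := ih (by omega)
      by_contra hcon
      have h2 := hq (c - (d + 1)) (by omega)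
      have h3 : c - d = c - (d + 1) + 1 := by omega
      rw [h3] at h1
      have h4 := hb (c - (d + 1)) (by omega) (by omega) h1
      have h5 := hz _ _ (hp (c - (d + 1)) (by omega)) (by omega) h1
      omega
  intro i hi h1 _
  have := key (c - i) (by omega)
  rw [show c - (c - i) = i by omega] at this
  omega

theorem below_of_level_zero (hF : IsStrip x ℓ F) (hp : ∀ i < c, F (p i) (p (i + 1)))
    (hq : ℓ q = 0) : Below x ℓ p c q := by
  intro i hi h1 h2
  have := hF.ne_min _ _ _ (hp i hi) h1 h2
  omega

end IsStrip

/-! ### The half: a refining strip of `m + 1` levels -/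

/-- The arcs of the planar part of the construction: vertices are pairs (height, index). -/
inductive Fwd (m : ℕ) : ℕ × ℕ → ℕ × ℕ → Prop
  | lane (k t : ℕ) (hk : k ≤ m) : Fwd m (k, t) (k, t + 1)
  | right (k t u s : ℕ) (hk : k + 1 ≤ m) (hs : s < m) (hu : u = 2 * m * t + s) :
      Fwd m (k, t) (k + 1, u)
  | left (k t u s : ℕ) (hk : k + 1 ≤ m) (hs : 1 ≤ s) (hs' : s ≤ m) (hu : u + s = 2 * m * t) :
      Fwd m (k + 1, u) (k, t)

/-- The abscissa: `(k, t)` is placed at `t / (2 * m) ^ k`, ties being broken by the height. -/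
def abscissa (m : ℕ) (v : ℕ × ℕ) : ℕ := v.2 * (2 * m) ^ (m - v.1) * (m + 1) + v.1

theorem abscissa_lt_iff {m : ℕ} {v w : ℕ × ℕ} (hv : v.1 ≤ m) (hw : w.1 ≤ m) :
    abscissa m v < abscissa m w ↔ v.2 * (2 * m) ^ (m - v.1) < w.2 * (2 * m) ^ (m - w.1) ∨
      v.2 * (2 * m) ^ (m - v.1) = w.2 * (2 * m) ^ (m - w.1) ∧ v.1 < w.1 := by
  unfold abscissa
  generalize v.2 * (2 * m) ^ (m - v.1) = a
  generalize w.2 * (2 * m) ^ (m - w.1) = b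
  rcases lt_trichotomy a b with h | h | h
  · have : (a + 1) * (m + 1) ≤ b * (m + 1) := Nat.mul_le_mul_right _ h
    constructor
    · intro _; exact Or.inl h
    · intro _; nlinarith
  · subst h
    constructor
    · intro h; right; exact ⟨rfl, by omega⟩
    · rintro (h | ⟨_, h⟩) <;> omega
  · have : (b + 1) * (m + 1) ≤ a * (m + 1) := Nat.mul_le_mul_right _ h
    constructor
    · intro _; nlinarith
    · rintro (h' | ⟨h', _⟩) <;> omega

theorem abscissa_inj {m : ℕ} (hm : 0 < m) {v w : ℕ × ℕ} (hv : v.1 ≤ m) (hw : w.1 ≤ m)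
    (h : abscissa m v = abscissa m w) : v = w := by
  have h1 : ¬ abscissa m v < abscissa m w := by omega
  have h2 : ¬ abscissa m w < abscissa m v := by omega
  rw [abscissa_lt_iff hv hw] at h1
  rw [abscissa_lt_iff hw hv] at h2
  have h3 : v.1 = w.1 := by omega
  have h4 : v.2 * (2 * m) ^ (m - v.1) = w.2 * (2 * m) ^ (m - w.1) := by omega
  rw [h3] at h4
  exact Prod.ext h3 (Nat.eq_of_mul_eq_mul_right (by positivity) h4)

theorem abscissa_lt_iff_of_same {m k t u : ℕ} (hm : 0 < m) (hk : k ≤ m) :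
    abscissa m (k, t) < abscissa m (k, u) ↔ t < u := by
  rw [abscissa_lt_iff hk hk]
  simp only [lt_self_iff_false, and_false, or_false]
  exact Nat.mul_lt_mul_right (by positivity)

theorem abscissa_lt_child {m k t u : ℕ} (hm : 0 < m) (hk : k + 1 ≤ m) :
    abscissa m (k, t) < abscissa m (k + 1, u) ↔ 2 * m * t ≤ u := by
  rw [abscissa_lt_iff (by simpa using by omega) hk]
  have : (2 * m) ^ (m - k) = (2 * m) * (2 * m) ^ (m - (k + 1)) := by
    rw [← pow_succ']; congr 1; omega
  simp only [this]
  have hpos : 0 < (2 * m) ^ (m - (k + 1)) := by positivity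
  generalize (2 * m) ^ (m - (k + 1)) = E at hpos
  rw [show t * (2 * m * E) = (2 * m * t) * E by ring]
  constructor
  · rintro (h | ⟨h, _⟩)
    · exact (Nat.lt_of_mul_lt_mul_right h).le
    · exact (Nat.eq_of_mul_eq_mul_right hpos h).le
  · intro h
    rcases h.lt_or_eq with h | h
    · exact Or.inl (Nat.mul_lt_mul_of_pos_right h hpos)
    · exact Or.inr ⟨by rw [h], by simp⟩

theorem child_lt_abscissa {m k t u : ℕ} (hm : 0 < m) (hk : k + 1 ≤ m) :
    abscissa m (k + 1, u) < abscissa m (k, t) ↔ u < 2 * m * t := by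
  have h1 := abscissa_lt_child (t := t) (u := u) hm hk
  have h2 : abscissa m (k, t) ≠ abscissa m (k + 1, u) := by
    intro h
    have := abscissa_inj hm (by simpa using by omega) hk h
    simp at this
  omega

/-- Tree arcs at `(k, t)` stay strictly between its neighbours on level `k`. For `descend`: between
consecutive parents the first `m` children are entered from the left parent and the last `m` lead to
the right parent, so no vertex under a descending arc is entered from below. -/
theorem isStrip_fwd {m : ℕ} (hm : 0 < m) : IsStrip (abscissa m) Prod.fst (Fwd m) where
  lt := by
    rintro _ _ (⟨k, t, hk⟩ | ⟨k, t, u, s, hk, hs, rfl⟩ | ⟨k, t, u, s, hk, hs, hs', hu⟩)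
    · exact (abscissa_lt_iff_of_same hm hk).2 (by omega)
    · exact (abscissa_lt_child hm hk).2 (by omega)
    · exact (child_lt_abscissa hm hk).2 (by omega)
  le_succ := by rintro _ _ (_ | _ | _) <;> simp; omega
  succ_ge := by rintro _ _ (_ | _ | _) <;> simp; omega
  ne_min := by
    rintro _ _ ⟨j, v⟩ (⟨k, t, hk⟩ | ⟨k, t, u, s, hk, hs, rfl⟩ | ⟨k, t, u, s, hk, hs, hs', hu⟩)
      h1 h2 h3
    · simp only [min_self] at h3
      subst h3
      rw [abscissa_lt_iff_of_same hm hk] at h1 h2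
      omega
    · simp only [le_add_iff_nonneg_right, zero_le, inf_of_le_left] at h3
      subst h3
      rw [abscissa_lt_iff_of_same hm (by omega)] at h1
      rw [abscissa_lt_child hm hk] at h2
      nlinarith
    · simp only [le_add_iff_nonneg_right, zero_le, inf_of_le_right] at h3
      subst h3
      rw [abscissa_lt_iff_of_same hm (by omega)] at h2
      rw [child_lt_abscissa hm hk] at h1
      nlinarith
  descend := by
    rintro _ _ ⟨j, v⟩ q (⟨k, t, hk⟩ | ⟨k, t, u, s, hk, hs, rfl⟩ | ⟨k, t, u, s, hk, hs, hs', hu⟩)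
      h1 h2 h3 h4 hq
    · simp at h1
    · simp at h1; omega
    · simp only at h4
      subst h4
      rw [abscissa_lt_iff_of_same hm hk] at h2
      rw [child_lt_abscissa hm hk] at h3
      by_contra hcon
      cases hq with
      | lane => simp at hcon
      | left => simp at hcon
      | right _ t' _ s' _ hs₂ hv =>
        rcases lt_or_ge t' t with h5 | h5
        · have : 2 * m * (t' + 1) ≤ 2 * m * t := Nat.mul_le_mul_left _ h5
          have : 2 * m * (t' + 1) = 2 * m * t' + 2 * m := by ring
          omega
        · have : 2 * m * t ≤ 2 * m * t' := Nat.mul_le_mul_left _ h5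
          omega

/-- The upper boundary of the strip: the leaves and the left ends of all levels. -/
def IsUpper (m : ℕ) (v : ℕ × ℕ) : Prop := v.1 = m ∨ v.2 = 0

theorem IsUpper.isTopOf {m : ℕ} (hm : 0 < m) {v : ℕ × ℕ} (hv : IsUpper m v) (hvm : v.1 ≤ m) :
    IsTopOf (abscissa m) Prod.fst (Fwd m) v := by
  intro u w huw h1 h2
  have hu : u.1 ≤ m ∧ w.1 ≤ m := by cases huw <;> simp <;> omega
  rcases hv with hv | hv
  · have := (isStrip_fwd hm).ne_min _ _ _ huw h1 h2
    omega
  · rw [abscissa_lt_iff hu.1 hvm, hv] at h1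
    omega

/-- The arcs of one half of the construction. -/
def HalfArc (m : ℕ) (u w : ℕ × ℕ) : Prop :=
  Fwd m u w ∨ u.1 = m ∧ w.2 = 0 ∧ w.1 < m

/-- The last vertex of level `k` in the left half. -/
def lastVertex (m k : ℕ) : ℕ × ℕ := (k, m * (2 * m) ^ k - 1)

def InHalf (m : ℕ) (v : ℕ × ℕ) : Prop := v.1 ≤ m ∧ v.2 < m * (2 * m) ^ v.1

theorem InHalf.pos_lt {m : ℕ} (hm : 0 < m) {v : ℕ × ℕ} (hv : InHalf m v) :
    v.2 * (2 * m) ^ (m - v.1) < m * (2 * m) ^ m := by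
  have : (2 * m) ^ m = (2 * m) ^ v.1 * (2 * m) ^ (m - v.1) := by
    rw [← pow_add]; congr 1; have := hv.1; omega
  rw [this, ← mul_assoc]
  exact Nat.mul_lt_mul_of_pos_right hv.2 (by positivity)

theorem HalfArc.below {m : ℕ} (hm : 0 < m) {p : ℕ → ℕ × ℕ} {c : ℕ}
    (hp : ∀ i < c, Fwd m (p i) (p (i + 1))) (hpm : ∀ i ≤ c, (p i).1 ≤ m)
    (h0 : IsUpper m (p 0)) {u w : ℕ × ℕ}
    (hc : m * (2 * m) ^ m ≤ (p c).2 * (2 * m) ^ (m - (p c).1))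
    (huw : HalfArc m u w) (hu : InHalf m u) (hup : ∀ i ≤ c, p i ≠ u)
    (hb : Below (abscissa m) Prod.fst p c u) : Below (abscissa m) Prod.fst p c w := by
  have hx : ∀ i ≤ c, abscissa m (p i) ≠ abscissa m u :=
    fun i hi h => hup i hi (abscissa_inj hm (hpm i hi) hu.1 h)
  rcases huw with huw | ⟨h1, h2, h3⟩
  · exact (isStrip_fwd hm).below_of_arc hp (h0.isTopOf hm (hpm 0 (by omega))) huw hx hb
  · refine IsStrip.below_of_hop (IsUpper.isTopOf hm (Or.inl h1) hu.1) hp hx ?_ hb ?_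
    · rw [abscissa_lt_iff hu.1 (hpm c le_rfl)]
      exact Or.inl ((hu.pos_lt hm).trans_le hc)
    · rw [abscissa_lt_iff h3.le hu.1, h2]
      rcases Nat.eq_zero_or_pos (u.2 * (2 * m) ^ (m - u.1)) with h | h <;> omega

/-- In the half, a forward path from the upper boundary that leaves at level `a` and a disjoint walk
from level zero that leaves at level `b` satisfy `b < a`. -/
theorem level_lt_of_disjoint {m : ℕ} (hm : 0 < m) {A W : List (ℕ × ℕ)} {a b : ℕ} {u w : ℕ × ℕ}
    (hA : A.IsChain (Fwd m)) (hAm : ∀ v ∈ A, InHalf m v) (hu : A.head? = some u)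
    (hu' : IsUpper m u) (ha : A.getLast? = some (lastVertex m a))
    (hW : W.IsChain (HalfArc m)) (hWm : ∀ v ∈ W, InHalf m v) (hw : W.head? = some w)
    (hw' : w.1 = 0) (hb : W.getLast? = some (lastVertex m b)) (hAW : A.Disjoint W) : b < a := by
  have haA := List.mem_of_getLast? ha
  have hbW := List.mem_of_getLast? hb
  have hpos : ∀ k, 0 < m * (2 * m) ^ k := fun k => by positivity
  -- A virtual vertex just beyond the right edge of the half; appending it makes the path end to the
  -- right of every vertex of the half.
  set z : ℕ × ℕ := (a, m * (2 * m) ^ a) with hz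
  have ham : a ≤ m := (hAm _ haA).1
  have hbm : b ≤ m := (hWm _ hbW).1
  set A' := A ++ [z] with hA'
  have hlast : Fwd m (lastVertex m a) z := by
    have h := Fwd.lane (m := m) a (m * (2 * m) ^ a - 1) ham
    rwa [Nat.sub_add_cancel (hpos a)] at h
  have hch : A'.IsChain (Fwd m) := by
    rw [hA', List.isChain_append]
    refine ⟨hA, by simp, ?_⟩
    intro y hy y' hy'
    rw [ha] at hy
    simp at hy hy'
    subst hy hy'
    exact hlast
  set p : ℕ → ℕ × ℕ := fun i => A'.getD i z with hpdef
  set c := A.length with hcdef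
  have hlen : A'.length = c + 1 := by simp [hA', hcdef]
  have hcpos : 0 < c := List.length_pos_of_mem haA
  have hp : ∀ i < c, Fwd m (p i) (p (i + 1)) := by
    intro i hi
    have := (List.isChain_iff_getElem.1 hch) i (by omega)
    simp only [hpdef]
    rwa [List.getD_eq_getElem _ _ (by omega), List.getD_eq_getElem _ _ (by omega)]
  have hpA : ∀ i < c, p i ∈ A := by
    intro i hi
    simp only [hpdef]
    rw [List.getD_eq_getElem _ _ (by omega), List.getElem_append_left hi]
    exact List.getElem_mem _
  have hpc : p c = z := by
    simp [hpdef, hA', hcdef]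
  have hpc1 : p (c - 1) = lastVertex m a := by
    simp only [hpdef]
    rw [List.getD_eq_getElem _ _ (by omega), List.getElem_append_left (by omega)]
    rw [List.getLast?_eq_getElem?] at ha
    exact (List.getElem?_eq_some_iff.1 ha).2
  have hp0 : p 0 = u := by
    simp only [hpdef]
    rw [List.getD_eq_getElem _ _ (by omega), List.getElem_append_left hcpos]
    rw [List.head?_eq_getElem?] at hu
    exact (List.getElem?_eq_some_iff.1 hu).2
  have hpm : ∀ i ≤ c, (p i).1 ≤ m := by
    intro i hi
    rcases hi.lt_or_eq with h | h
    · exact (hAm _ (hpA i h)).1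
    · rw [h, hpc]; exact ham
  have hpW : ∀ v ∈ W, ∀ i ≤ c, p i ≠ v := by
    rintro v hv i hi rfl
    rcases hi.lt_or_eq with h | h
    · exact hAW (hpA i h) hv
    · have := (hWm _ hv).2
      rw [h, hpc] at this
      simp [hz] at this
  have hpow : ∀ k ≤ m, m * (2 * m) ^ k * (2 * m) ^ (m - k) = m * (2 * m) ^ m := by
    intro k hk
    rw [mul_assoc, ← pow_add]; congr 2; omega
  have hall : ∀ v ∈ W, Below (abscissa m) Prod.fst p c v := by
    have : ∀ W' : List (ℕ × ℕ), W'.IsChain (HalfArc m) → (∀ v ∈ W', v ∈ W) →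
        (∀ v ∈ W'.head?, Below (abscissa m) Prod.fst p c v) →
        ∀ v ∈ W', Below (abscissa m) Prod.fst p c v := by
      intro W'
      induction W' with
      | nil => simp
      | cons y W' ih =>
        intro hc1 hsub hhd v hv
        have hy := hhd y (by simp)
        rcases List.mem_cons.1 hv with rfl | hv
        · exact hy
        · refine ih hc1.tail (fun v hv => hsub v (List.mem_cons_of_mem _ hv)) ?_ v hv
          intro y' hy'
          have harc : HalfArc m y y' := by
            rw [List.isChain_cons] at hc1
            exact hc1.1 y' hy'
          have hyW := hsub y (by simp)
          exact HalfArc.below hm hp hpm (by rwa [hp0]) (by rw [hpc]; exact (hpow a ham).ge)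
            harc (hWm y hyW) (hpW y hyW) hy
    refine this W hW (fun _ h => h) ?_
    intro v hv
    rw [hw] at hv
    simp at hv
    subst hv
    exact (isStrip_fwd hm).below_of_level_zero hp hw'
  by_contra hcon
  rcases (not_lt.1 hcon).lt_or_eq with hlt | heq
  · have hB := hall _ hbW (c - 1) (by omega)
    have e : c - 1 + 1 = c := by omega
    rw [e, hpc1, hpc] at hB
    -- If `a < b`, the finer level ends closer to the right edge, so the exit of level `b` lies over
    -- the last arc, from the exit of level `a` to `z`, and not below it.
    have hE : (2 * m) ^ (m - b) < (2 * m) ^ (m - a) := Nat.pow_lt_pow_right (by omega) (by omega)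
    have hEb : 0 < (2 * m) ^ (m - b) := by positivity
    have q1 := hpow a ham
    have q2 := hpow b hbm
    have hge : ∀ k ≤ m, (2 * m) ^ (m - k) ≤ m * (2 * m) ^ k * (2 * m) ^ (m - k) :=
      fun k _ => Nat.le_mul_of_pos_left _ (hpos k)
    have g1 := hge a ham
    have g2 := hge b hbm
    have h1 : abscissa m (lastVertex m a) < abscissa m (lastVertex m b) := by
      rw [abscissa_lt_iff ham hbm]
      left
      simp only [lastVertex, Nat.sub_mul, one_mul, q1, q2]
      omega
    have h2 : abscissa m (lastVertex m b) < abscissa m z := by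
      rw [abscissa_lt_iff hbm ham]
      left
      simp only [lastVertex, hz, Nat.sub_mul, one_mul, q1, q2]
      omega
    have := hB h1 h2
    simp [lastVertex, hz] at this
    omega
  · subst heq
    exact hAW haA hbW

/-! ### The two halves glued, and the impossibility of two disjoint paths -/

/-- The vertices of the non-linked digraph: two half-planes and four terminals. -/
inductive Vtx
  | L (p : ℕ × ℕ)
  | R (p : ℕ × ℕ)
  | s (i : Bool)
  | t (i : Bool)

namespace Vtx

/-- The arcs: each half carries `HalfArc`, reversed in the right half. The source `s i` is entered
from everywhere and the sink `t i` is left to everywhere. -/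
def Arc (m : ℕ) : Vtx → Vtx → Prop
  | u, s i => u ≠ s i
  | t i, v => v ≠ t i
  | L p, L q => HalfArc m p q
  | R p, R q => HalfArc m q p
  | L p, R q => p = q ∧ p.2 + 1 = m * (2 * m) ^ p.1
  | R p, L q => IsUpper m p ∧ IsUpper m q
  | s false, L p => IsUpper m p
  | s true, L p => p.1 = 0
  | R p, t true => IsUpper m p
  | R p, t false => p.1 = 0
  | _, _ => False

/-- Reversing all arcs and exchanging the two halves is a symmetry. -/
def dual : Vtx → Vtx
  | L p => R p
  | R p => L p
  | s i => t (!i)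
  | t i => s (!i)

theorem dual_dual (v : Vtx) : v.dual.dual = v := by
  cases v <;> simp [dual]

theorem dual_injective : Function.Injective dual :=
  Function.LeftInverse.injective dual_dual

theorem Arc.dual {m : ℕ} {u v : Vtx} (h : Arc m u v) : Arc m v.dual u.dual := by
  rcases u with p | p | (_ | _) | (_ | _) <;> rcases v with q | q | (_ | _) | (_ | _) <;>
    first
    | (obtain ⟨rfl, h⟩ := h; exact ⟨rfl, h⟩)
    | simp_all [Arc, Vtx.dual]

def IsValid (m : ℕ) : Vtx → Prop
  | L p => InHalf m p
  | R p => InHalf m p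
  | _ => True

theorem IsValid.dual {m : ℕ} {v : Vtx} (h : IsValid m v) : IsValid m v.dual := by
  cases v <;> simp_all [IsValid, Vtx.dual]

/-- A path through the left half from `A` to the exit of level `a` and back through the right half
along `B` to level zero. -/
def Passes (m : ℕ) (A B : List (ℕ × ℕ)) (a : ℕ) : Prop :=
  A.IsChain (Fwd m) ∧ B.IsChain (flip (HalfArc m)) ∧
    A.getLast? = some (lastVertex m a) ∧ B.head? = some (lastVertex m a) ∧
      ∃ w, B.getLast? = some w ∧ w.1 = 0

/-- Membership in `P` is all that is recorded of the position of `A` and `B`, since only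
disjointness is used later. -/
def PassesFromUpper (m : ℕ) (P : List Vtx) : Prop :=
  ∃ A B a u, Passes m A B a ∧ A.head? = some u ∧ IsUpper m u ∧ (∀ p ∈ A, L p ∈ P) ∧
    ∀ p ∈ B, R p ∈ P

theorem PassesFromUpper.cons {m : ℕ} {P : List Vtx} (h : PassesFromUpper m P) (v : Vtx) :
    PassesFromUpper m (v :: P) := by
  obtain ⟨A, B, a, u, h1, h2, h3, h4, h5⟩ := h
  exact ⟨A, B, a, u, h1, h2, h3, fun p hp => List.mem_cons_of_mem _ (h4 p hp),
    fun p hp => List.mem_cons_of_mem _ (h5 p hp)⟩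

theorem Passes.fromUpper {m : ℕ} {A B : List (ℕ × ℕ)} {a : ℕ} {u : ℕ × ℕ} {P : List Vtx}
    (h : Passes m A B a) (hu : A.head? = some u) (hu' : IsUpper m u)
    (hP : P = A.map L ++ (B.map R ++ [t false])) : PassesFromUpper m P := by
  subst hP
  exact ⟨A, B, a, u, h, hu, hu', fun p hp => by simp [hp], fun p hp => by simp [hp]⟩

/-- Read backwards from `t false`, the path is in one of four states: at the sink only, still in the
right half, in the left half on forward arcs after one crossing, or done. It is done once a hop or
an arc from the right half enters `A`, because both enter at the upper boundary. -/
theorem suffix_cases {m : ℕ} {P : List Vtx} (hc : P.IsChain (Arc m)) (hn : P.Nodup)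
    (hl : P.getLast? = some (t false)) (hs : ∀ i, s i ∉ P) (ht : t true ∉ P) :
    P = [t false] ∨
      (∃ B w, B.IsChain (flip (HalfArc m)) ∧ B ≠ [] ∧ B.getLast? = some w ∧ w.1 = 0 ∧
        P = B.map R ++ [t false]) ∨
      (∃ A B a, Passes m A B a ∧ P = A.map L ++ (B.map R ++ [t false])) ∨
      PassesFromUpper m P := by
  induction P with
  | nil => simp at hl
  | cons v P ih =>
    rcases P with _ | ⟨v', P⟩
    · left; simpa using hl
    right
    have harc : Arc m v v' := by
      rw [List.isChain_cons_cons] at hc; exact hc.1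
    rw [List.nodup_cons] at hn
    rw [List.getLast?_cons_cons] at hl
    have hvs : ∀ i, v ≠ s i := fun i h => hs i (by simp [h])
    have hvt : v ≠ t true := fun h => ht (by simp [h])
    have hvf : v ≠ t false := fun h => hn.1 (h ▸ List.mem_of_getLast? hl)
    have ih := ih hc.tail hn.2 hl (fun i h => hs i (List.mem_cons_of_mem _ h))
      (fun h => ht (List.mem_cons_of_mem _ h))
    rcases v with p | p | i | i
    rotate_left 2
    · exact absurd rfl (hvs i)
    · cases i
      · exact absurd rfl hvf
      · exact absurd rfl hvt
    · rcases ih with ih | ⟨B, w, hB, hB0, hw, hw0, hP⟩ | ⟨A, B, a, hAB, hP⟩ | ih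
      · simp at ih
        rw [ih.1] at harc
        simp [Arc] at harc
      · rcases B with _ | ⟨q, B⟩
        · exact absurd rfl hB0
        simp at hP
        rw [hP.1] at harc
        obtain ⟨rfl, h2⟩ := harc
        have hp : p = lastVertex m p.1 := Prod.ext rfl (by simp [lastVertex]; omega)
        right; left
        refine ⟨[p], p :: B, p.1, ⟨by simp, hB, by simpa using hp, by simpa using hp, w, hw, hw0⟩, ?_⟩
        simp [hP]
      · rcases A with _ | ⟨q, A⟩
        · simp [Passes] at hAB
        have hP' := hP
        simp at hP
        rw [hP.1] at harc
        rcases harc with harc | harc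
        · right; left
          refine ⟨p :: q :: A, B, a, ⟨?_, hAB.2.1, ?_, hAB.2.2.2⟩, ?_⟩
          · exact List.isChain_cons_cons.2 ⟨harc, hAB.1⟩
          · rw [List.getLast?_cons_cons]; exact hAB.2.2.1
          · simp [hP]
        · right; right
          exact (hAB.fromUpper (u := q) (by simp) (Or.inr harc.2.1) hP').cons _
      · right; right; exact ih.cons _
    · rcases ih with ih | ⟨B, w, hB, hB0, hw, hw0, hP⟩ | ⟨A, B, a, hAB, hP⟩ | ih
      · simp at ih
        rw [ih.1] at harc
        left
        refine ⟨[p], p, by simp, by simp, by simp, harc, by simp [ih]⟩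
      · left
        rcases B with _ | ⟨q, B⟩
        · exact absurd rfl hB0
        simp at hP
        rw [hP.1] at harc
        refine ⟨p :: q :: B, w, List.isChain_cons_cons.2 ⟨harc, hB⟩, by simp, ?_, hw0, by simp [hP]⟩
        rw [List.getLast?_cons_cons]; exact hw
      · rcases A with _ | ⟨q, A⟩
        · simp [Passes] at hAB
        have hP' := hP
        simp at hP
        rw [hP.1] at harc
        right; right
        exact (hAB.fromUpper (u := q) (by simp) harc.2 hP').cons _
      · right; right; exact ih.cons _

theorem passesFromUpper_of_path {m : ℕ} {P : List Vtx} (hc : P.IsChain (Arc m)) (hn : P.Nodup)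
    (hh : P.head? = some (s false)) (hl : P.getLast? = some (t false)) (hs : s true ∉ P)
    (ht : t true ∉ P) : PassesFromUpper m P := by
  rcases P with _ | ⟨v, P⟩
  · simp at hh
  obtain rfl : v = s false := by simpa using hh
  rcases P with _ | ⟨v', P⟩
  · simp at hl
  rw [List.isChain_cons_cons] at hc
  rw [List.nodup_cons] at hn
  rw [List.getLast?_cons_cons] at hl
  have harc := hc.1
  rcases suffix_cases hc.2 hn.2 hl
    (by rintro (_ | _) h; exacts [hn.1 h, hs (List.mem_cons_of_mem _ h)])
    (fun h => ht (List.mem_cons_of_mem _ h)) with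
    ih | ⟨B, w, hB, hB0, hw, hw0, hP⟩ | ⟨A, B, a, hAB, hP⟩ | ih
  · simp at ih
    rw [ih.1] at harc
    simp [Arc] at harc
  · rcases B with _ | ⟨q, B⟩
    · exact absurd rfl hB0
    simp at hP
    rw [hP.1] at harc
    simp [Arc] at harc
  · rcases A with _ | ⟨q, A⟩
    · simp [Passes] at hAB
    have hP' := hP
    simp at hP
    rw [hP.1] at harc
    exact (hAB.fromUpper (u := q) (by simp) harc hP').cons _
  · exact ih.cons _

/-- There are no disjoint paths from `s false` to `t false` and from `s true` to `t true`. -/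
theorem not_disjoint_paths {m : ℕ} (hm : 0 < m) {P Q : List Vtx} (hP : P.IsChain (Arc m))
    (hPn : P.Nodup) (hPh : P.head? = some (s false)) (hPl : P.getLast? = some (t false))
    (hPv : ∀ v ∈ P, IsValid m v) (hQ : Q.IsChain (Arc m)) (hQn : Q.Nodup)
    (hQh : Q.head? = some (s true)) (hQl : Q.getLast? = some (t true))
    (hQv : ∀ v ∈ Q, IsValid m v) : ¬ P.Disjoint Q := by
  intro hPQ
  have hd : ∀ v, v ∈ (Q.map dual).reverse ↔ v.dual ∈ Q := by
    intro v
    simp only [List.mem_reverse, List.mem_map]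
    exact ⟨by rintro ⟨x, hx, rfl⟩; rwa [dual_dual], fun h => ⟨_, h, dual_dual v⟩⟩
  have h1 := passesFromUpper_of_path hP hPn hPh hPl
    (fun h => hPQ h (List.mem_of_mem_head? hQh)) (fun h => hPQ h (List.mem_of_getLast? hQl))
  -- Reversal and exchange of the halves turn `Q` into another path from `s false` to `t false`.
  have h2 : PassesFromUpper m (Q.map dual).reverse := by
    refine passesFromUpper_of_path ?_ ?_ ?_ ?_ ?_ ?_
    · rw [List.isChain_reverse, List.isChain_map]
      exact hQ.imp fun u v h => h.dual
    · exact List.nodup_reverse.2 (hQn.map dual_injective)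
    · simp [hQl, dual]
    · simp [hQh, dual]
    · rw [hd]; exact fun h => hPQ (List.mem_of_getLast? hPl) h
    · rw [hd]; exact fun h => hPQ (List.mem_of_mem_head? hPh) h
  obtain ⟨A, B, a, u, ⟨hA, hB, hAl, hBh, w, hBl, hw⟩, hAh, hu, hAP, hBP⟩ := h1
  obtain ⟨A', B', a', u', ⟨hA', hB', hAl', hBh', w', hBl', hw'⟩, hAh', hu', hAP', hBP'⟩ := h2
  have hAQ : ∀ p ∈ A', R p ∈ Q := fun p hp => (hd _).1 (hAP' p hp)
  have hBQ : ∀ p ∈ B', L p ∈ Q := fun p hp => (hd _).1 (hBP' p hp)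
  have e1 : a' < a := level_lt_of_disjoint hm hA (fun v hv => hPv _ (hAP v hv)) hAh hu hAl
    (List.isChain_reverse.2 hB') (fun v hv => hQv _ (hBQ v (List.mem_reverse.1 hv)))
    (by simpa using hBl') hw' (by simpa using hBh')
    (fun v hv hv' => hPQ (hAP v hv) (hBQ v (List.mem_reverse.1 hv')))
  have e2 : a < a' := level_lt_of_disjoint hm hA' (fun v hv => hQv _ (hAQ v hv)) hAh' hu' hAl'
    (List.isChain_reverse.2 hB) (fun v hv => hPv _ (hBP v (List.mem_reverse.1 hv)))
    (by simpa using hBl) hw (by simpa using hBh)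
    (fun v hv hv' => hPQ (hBP v (List.mem_reverse.1 hv')) (hAQ v hv))
  omega

end Vtx

/-! ### Connectivity after fewer than `m` deletions -/

/-- Pairwise disjoint sets `C s`, `s < m`, cannot all be met by fewer than `m` points. -/
theorem exists_lt_forall_notMem {α : Type*} {m : ℕ} {X : Finset α} (hX : X.card < m)
    (C : ℕ → Set α) (hC : ∀ s < m, ∀ s' < m, ∀ v, v ∈ C s → v ∈ C s' → s = s') :
    ∃ s < m, ∀ v ∈ C s, v ∉ X := by
  by_contra! h
  have : Nonempty α := by
    obtain ⟨v, -⟩ := h (X.card) hX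
    exact ⟨v⟩
  choose! g hg using h
  have := Finset.card_le_card_of_injOn (s := Finset.range m) (t := X) g
    (fun s hs => (hg s (by simpa using hs)).2)
    (fun s hs s' hs' h => hC s (by simpa using hs) s' (by simpa using hs') (g s)
      (hg s (by simpa using hs)).1 (h ▸ (hg s' (by simpa using hs')).1))
  simp at this
  omega

/-- A walk can be shortened to a path. -/
theorem exists_nodup_chain {α : Type*} {r : α → α → Prop} {x y : α}
    (h : Relation.ReflTransGen r x y) :
    ∃ p : List α, p.IsChain r ∧ p.Nodup ∧ p.head? = some x ∧ p.getLast? = some y := by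
  induction h using Relation.ReflTransGen.head_induction_on with
  | refl => exact ⟨[y], by simp⟩
  | @head x x' hx _ ih =>
    obtain ⟨p, hc, hn, hh, hl⟩ := ih
    by_cases hp : x ∈ p
    · obtain ⟨l₁, l₂, rfl⟩ := List.append_of_mem hp
      refine ⟨x :: l₂, (List.isChain_append.1 hc).2.1, (List.nodup_append.1 hn).2.1, rfl, ?_⟩
      rwa [List.getLast?_append_of_ne_nil _ (by simp)] at hl
    · refine ⟨x :: p, ?_, List.nodup_cons.2 ⟨hp, hn⟩, rfl, ?_⟩
      · rw [List.isChain_cons]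
        refine ⟨fun z hz => ?_, hc⟩
        rw [hh] at hz
        simp at hz
        exact hz ▸ hx
      · rcases p with _ | ⟨z, p⟩
        · simp at hh
        · rwa [List.getLast?_cons_cons]

theorem InHalf.child {m k t u : ℕ} (h : InHalf m (k, t)) (hk : k + 1 ≤ m)
    (hu : u < 2 * m * (t + 1)) : InHalf m (k + 1, u) := by
  refine ⟨hk, hu.trans_le ?_⟩
  have h2 : t + 1 ≤ m * (2 * m) ^ k := h.2
  calc 2 * m * (t + 1) ≤ 2 * m * (m * (2 * m) ^ k) := Nat.mul_le_mul_left _ h2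
    _ = m * (2 * m) ^ (k + 1) := by ring

namespace Vtx

variable {m : ℕ} {X : Finset Vtx} {k₀ : ℕ} {u v : Vtx}

/-- `v` is a vertex that survives the deletion of `X`. -/
def Alive (m : ℕ) (X : Finset Vtx) (v : Vtx) : Prop := IsValid m v ∧ v ∉ X

def Step (m : ℕ) (X : Finset Vtx) (u v : Vtx) : Prop := Arc m u v ∧ Alive m X u ∧ Alive m X v

abbrev Reach (m : ℕ) (X : Finset Vtx) : Vtx → Vtx → Prop := Relation.ReflTransGen (Step m X)

def dualSet (X : Finset Vtx) : Finset Vtx := X.map ⟨dual, dual_injective⟩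

theorem mem_dualSet : v ∈ dualSet X ↔ v.dual ∈ X := by
  simp only [dualSet, Finset.mem_map, Function.Embedding.coeFn_mk]
  exact ⟨by rintro ⟨x, hx, rfl⟩; rwa [dual_dual], fun h => ⟨_, h, dual_dual v⟩⟩

theorem Alive.dual (h : Alive m X v) : Alive m (dualSet X) v.dual :=
  ⟨h.1.dual, by rw [mem_dualSet, dual_dual]; exact h.2⟩

theorem Alive.of_dualSet (h : Alive m (dualSet X) v) : Alive m X v.dual :=
  ⟨h.1.dual, by rw [← mem_dualSet]; exact h.2⟩

theorem Reach.of_dualSet (h : Reach m (dualSet X) u v) : Reach m X v.dual u.dual := by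
  induction h with
  | refl => exact .refl
  | tail _ h ih => exact .head ⟨h.1.dual, h.2.2.of_dualSet, h.2.1.of_dualSet⟩ ih

/-- No vertex of level `k` has been deleted. -/
structure IsClear (m : ℕ) (X : Finset Vtx) (k : ℕ) : Prop where
  lt : k < m
  left : ∀ t, L (k, t) ∉ X
  right : ∀ t, R (k, t) ∉ X

theorem IsClear.dual (h : IsClear m X k₀) : IsClear m (dualSet X) k₀ :=
  ⟨h.lt, fun t => by rw [mem_dualSet]; exact h.right t,
    fun t => by rw [mem_dualSet]; exact h.left t⟩

theorem exists_isClear (hX : X.card < m) : ∃ k, IsClear m X k := by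
  obtain ⟨k, hk, h⟩ := exists_lt_forall_notMem hX
    (fun k => {v | ∃ t, v = L (k, t) ∨ v = R (k, t)})
    (by rintro k - k' - v ⟨t, rfl | rfl⟩ ⟨t', h | h⟩ <;> simp at h <;> exact h.1)
  exact ⟨k, hk, fun t => h _ ⟨t, Or.inl rfl⟩, fun t => h _ ⟨t, Or.inr rfl⟩⟩

theorem IsClear.alive_left (h : IsClear m X k₀) {t : ℕ} (ht : t < m * (2 * m) ^ k₀) :
    Alive m X (L (k₀, t)) := ⟨⟨h.lt.le, ht⟩, h.left t⟩

theorem IsClear.alive_base (h : IsClear m X k₀) : Alive m X (L (k₀, 0)) := by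
  have := h.lt
  have hm : 0 < m := by omega
  exact h.alive_left (by positivity)

theorem IsClear.alive_base_right (h : IsClear m X k₀) : Alive m X (R (k₀, 0)) :=
  h.dual.alive_base.of_dualSet

/-- The `m` branches have distinct starting points on level `k + 1`, and an injective `f` keeps them
apart on all later levels. -/
theorem exists_branch (hX : X.card < m) (k : ℕ) {f g : ℕ → ℕ} (hf : f.Injective)
    (hg : ∀ s < m, ∀ s' < m, g s = g s' → s = s') :
    ∃ s < m, ∀ i, L (k + 1 + i, f^[i] (g s)) ∉ X := by
  obtain ⟨s, hs, h⟩ := exists_lt_forall_notMem hX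
    (fun s => {v | ∃ i, v = L (k + 1 + i, f^[i] (g s))}) (by
      rintro s hs s' hs' v ⟨i, rfl⟩ ⟨j, h⟩
      simp only [L.injEq, Prod.mk.injEq, Nat.add_left_cancel_iff] at h
      obtain ⟨rfl, h⟩ := h
      exact hg s hs s' hs' (hf.iterate i h))
  exact ⟨s, hs, fun i => h _ ⟨i, rfl⟩⟩

/-- Following right children, every vertex of the left half leads to a leaf. -/
theorem reach_leaf (hX : X.card < m) {p : ℕ × ℕ} (hp : Alive m X (L p)) :
    ∃ t, Alive m X (L (m, t)) ∧ Reach m X (L p) (L (m, t)) := by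
  obtain ⟨k, t⟩ := p
  have hm : 0 < m := by omega
  rcases (hp.1.1 : k ≤ m).eq_or_lt with rfl | hk
  · exact ⟨t, hp, .refl⟩
  -- After a free choice among `m` right children, the branch always takes the first one.
  obtain ⟨s, hs, h⟩ := exists_branch hX k (f := fun c => 2 * m * c)
    (g := fun s => 2 * m * t + s) (fun a b hab => Nat.eq_of_mul_eq_mul_left (by omega) hab)
    (by simp)
  have key : ∀ i, k + 1 + i ≤ m →
      Alive m X (L (k + 1 + i, (fun c => 2 * m * c)^[i] (2 * m * t + s))) ∧
      Reach m X (L (k, t)) (L (k + 1 + i, (fun c => 2 * m * c)^[i] (2 * m * t + s))) := by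
    intro i
    induction i with
    | zero =>
      intro hi
      have ha : Alive m X (L (k + 1, 2 * m * t + s)) :=
        ⟨InHalf.child hp.1 hi (by rw [mul_add]; omega), h 0⟩
      exact ⟨ha, .single ⟨Or.inl (.right k t _ s hi hs rfl), hp, ha⟩⟩
    | succ i ih =>
      intro hi
      obtain ⟨h1, h2⟩ := ih (by omega)
      have hn := h (i + 1)
      rw [Function.iterate_succ_apply'] at hn ⊢
      generalize (fun c => 2 * m * c)^[i] (2 * m * t + s) = c at *
      have ha : Alive m X (L (k + 1 + (i + 1), 2 * m * c)) :=
        ⟨InHalf.child h1.1 hi (by rw [mul_add]; omega), hn⟩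
      exact ⟨ha, h2.tail ⟨Or.inl (.right (k + 1 + i) c _ 0 hi hm rfl), h1, ha⟩⟩
  have := key (m - (k + 1)) (by omega)
  rw [show k + 1 + (m - (k + 1)) = m by omega] at this
  exact ⟨_, this⟩

theorem reach_base_of_left (hX : X.card < m) (hk : IsClear m X k₀) {p : ℕ × ℕ}
    (hp : Alive m X (L p)) : Reach m X (L p) (L (k₀, 0)) := by
  obtain ⟨t, ht, h⟩ := reach_leaf hX hp
  exact h.tail ⟨Or.inr ⟨rfl, rfl, hk.lt⟩, ht, hk.alive_base⟩

/-- Following left children backwards, every vertex of the left half is reached from the upper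
boundary. -/
theorem reach_of_upper (hX : X.card < m) {p : ℕ × ℕ} (hp : Alive m X (L p)) :
    ∃ q, IsUpper m q ∧ Alive m X (L q) ∧ Reach m X (L q) (L p) := by
  obtain ⟨k, t⟩ := p
  have hm : 0 < m := by omega
  rcases (hp.1.1 : k ≤ m).eq_or_lt with rfl | hk
  · exact ⟨_, Or.inl rfl, hp, .refl⟩
  rcases Nat.eq_zero_or_pos t with rfl | ht
  · exact ⟨_, Or.inr rfl, hp, .refl⟩
  have hpos : ∀ c, 0 < c → 2 * m ≤ 2 * m * c := fun c hc => Nat.le_mul_of_pos_right _ hc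
  -- After a free choice among `m` left children, the branch takes the nearest one. With truncated
  -- subtraction `f 0 = 0`, so `f` is injective on all of `ℕ`; `key` keeps the index positive, as
  -- index zero has no left child.
  obtain ⟨s, hs, h⟩ := exists_branch hX k (f := fun c => 2 * m * c - 1)
    (g := fun s => 2 * m * t - (s + 1)) (by
      intro a b hab
      dsimp only at hab
      rcases Nat.eq_zero_or_pos a with rfl | ha <;> rcases Nat.eq_zero_or_pos b with rfl | hb
      · rfl
      · have := hpos b hb; omega
      · have := hpos a ha; omega
      · have h1 := hpos b hb
        have h2 := hpos a ha
        exact Nat.eq_of_mul_eq_mul_left (show 0 < 2 * m by omega) (by omega))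
    (by intro s hs s' hs' h; have := hpos t ht; omega)
  have key : ∀ i, k + 1 + i ≤ m →
      0 < (fun c => 2 * m * c - 1)^[i] (2 * m * t - (s + 1)) ∧
      Alive m X (L (k + 1 + i, (fun c => 2 * m * c - 1)^[i] (2 * m * t - (s + 1)))) ∧
      Reach m X (L (k + 1 + i, (fun c => 2 * m * c - 1)^[i] (2 * m * t - (s + 1))))
        (L (k, t)) := by
    intro i
    induction i with
    | zero =>
      intro hi
      have := hpos t ht
      have ha : Alive m X (L (k + 1, 2 * m * t - (s + 1))) :=
        ⟨InHalf.child hp.1 hi (by rw [mul_add]; omega), h 0⟩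
      have h0 : 0 < 2 * m * t - (s + 1) := by omega
      have harc : Fwd m (k + 1, 2 * m * t - (s + 1)) (k, t) :=
        .left k t _ (s + 1) hi (by omega) (by omega) (by omega)
      exact ⟨h0, ha, .single ⟨Or.inl harc, ha, hp⟩⟩
    | succ i ih =>
      intro hi
      obtain ⟨h0, h1, h2⟩ := ih (by omega)
      have hn := h (i + 1)
      rw [Function.iterate_succ_apply'] at hn ⊢
      generalize (fun c => 2 * m * c - 1)^[i] (2 * m * t - (s + 1)) = c at *
      have := hpos c h0
      have ha : Alive m X (L (k + 1 + (i + 1), 2 * m * c - 1)) :=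
        ⟨InHalf.child h1.1 hi (by rw [mul_add]; omega), hn⟩
      have harc : Fwd m (k + 1 + i + 1, 2 * m * c - 1) (k + 1 + i, c) :=
        .left (k + 1 + i) c _ 1 hi le_rfl (by omega) (by omega)
      exact ⟨show 0 < 2 * m * c - 1 by omega, ha,
        Relation.ReflTransGen.head (b := L (k + 1 + i, c)) ⟨Or.inl harc, ha, h1⟩ h2⟩
  obtain ⟨-, h1, h2⟩ := key (m - (k + 1)) (by omega)
  rw [show k + 1 + (m - (k + 1)) = m by omega] at h1 h2
  exact ⟨_, Or.inl rfl, h1, h2⟩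

theorem reach_left_of_base (hX : X.card < m) (hk : IsClear m X k₀) {p : ℕ × ℕ}
    (hp : Alive m X (L p)) : Reach m X (R (k₀, 0)) (L p) := by
  obtain ⟨q, hq, hq', h⟩ := reach_of_upper hX hp
  have harc : Arc m (R (k₀, 0)) (L q) := ⟨Or.inr rfl, hq⟩
  exact h.head ⟨harc, hk.alive_base_right, hq'⟩

theorem card_dualSet : (dualSet X).card = X.card := Finset.card_map _

theorem reach_base (hX : X.card < m) (hk : IsClear m X k₀) (hv : Alive m X v) :
    Reach m X v (L (k₀, 0)) := by
  rcases v with p | p | (_ | _) | i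
  · exact reach_base_of_left hX hk hv
  · exact Reach.of_dualSet (u := R (k₀, 0)) (v := L p)
      (reach_left_of_base (by rwa [card_dualSet]) hk.dual hv.dual)
  · exact .single ⟨Or.inr rfl, hv, hk.alive_base⟩
  -- Level zero has exactly `m` vertices, so one of them survives.
  · obtain ⟨t, ht, h⟩ := exists_lt_forall_notMem hX (fun t => {L (0, t)})
      (by rintro s - s' - v rfl h; simpa using h)
    have ha : Alive m X (L (0, t)) := ⟨⟨by simp, by simpa using ht⟩, h _ rfl⟩
    have harc : Arc m (s true) (L (0, t)) := rfl
    exact (reach_base_of_left hX hk ha).head ⟨harc, hv, ha⟩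
  · exact .single ⟨by simp [Arc], hv, hk.alive_base⟩

theorem reach_of_base_right (hX : X.card < m) (hk : IsClear m X k₀) (hv : Alive m X v) :
    Reach m X (R (k₀, 0)) v := by
  have := (reach_base (by rwa [card_dualSet]) hk.dual hv.dual).of_dualSet
  rwa [dual_dual] at this

theorem reach_lane (hk : IsClear m X k₀) {t : ℕ} (ht : t < m * (2 * m) ^ k₀) :
    Reach m X (L (k₀, 0)) (L (k₀, t)) := by
  induction t with
  | zero => exact .refl
  | succ t ih =>
    exact (ih (by omega)).tail
      ⟨Or.inl (.lane k₀ t hk.lt.le), hk.alive_left (by omega), hk.alive_left ht⟩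

theorem reach_across (hk : IsClear m X k₀) : Reach m X (L (k₀, 0)) (R (k₀, 0)) := by
  have := hk.lt
  have hm : 0 < m := by omega
  have hpos : 0 < m * (2 * m) ^ k₀ := by positivity
  have hlt : m * (2 * m) ^ k₀ - 1 < m * (2 * m) ^ k₀ := by omega
  have h1 := reach_lane hk hlt
  have h2 := (reach_lane hk.dual hlt).of_dualSet
  have harc : Arc m (L (k₀, m * (2 * m) ^ k₀ - 1)) (R (k₀, m * (2 * m) ^ k₀ - 1)) :=
    ⟨rfl, Nat.sub_add_cancel hpos⟩
  exact (h1.tail ⟨harc, hk.alive_left hlt,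
    (hk.dual.alive_left hlt).of_dualSet⟩).trans h2

theorem reach_of_alive (hX : X.card < m) (hu : Alive m X u) (hv : Alive m X v) :
    Reach m X u v := by
  obtain ⟨k, hk⟩ := exists_isClear hX
  exact ((reach_base hX hk hu).trans (reach_across hk)).trans (reach_of_base_right hX hk hv)

theorem Arc.ne (hm : 0 < m) (h : Arc m u v) : u ≠ v := by
  have key : ∀ p, ¬ HalfArc m p p := by
    rintro p (h | ⟨h1, _, h2⟩)
    · exact lt_irrefl _ ((isStrip_fwd hm).lt _ _ h)
    · omega
  rintro rfl
  rcases u with p | p | i | i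
  · exact key _ h
  · exact key _ h
  · simp [Arc] at h
  · simp [Arc] at h

theorem finite_isValid (m : ℕ) : {v | IsValid m v}.Finite := by
  have h : {p | InHalf m p}.Finite := by
    refine ((Set.finite_Iic m).prod (Set.finite_Iio (m * (2 * m) ^ m))).subset ?_
    rintro p ⟨h1, h2⟩
    refine ⟨h1, h2.trans_le (Nat.mul_le_mul_left _ ?_)⟩
    rcases Nat.eq_zero_or_pos m with rfl | hm
    · simp at h2
    · exact Nat.pow_le_pow_right (by omega) h1
  refine (((h.image L).union (h.image R)).union
    ((Set.finite_range s).union (Set.finite_range t))).subset ?_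
  rintro (p | p | i | i) hv
  · exact Or.inl (Or.inl ⟨p, hv, rfl⟩)
  · exact Or.inl (Or.inr ⟨p, hv, rfl⟩)
  · exact Or.inr (Or.inl ⟨i, rfl⟩)
  · exact Or.inr (Or.inr ⟨i, rfl⟩)

end Vtx

/-! ### The finite digraph and its strength -/

/-- The digraph on the valid vertices, which is `l`-strong for all `l ≤ m` but not `2`-linked. -/
def unlinked (m : ℕ) : Digraph {v // Vtx.IsValid m v} where
  Adj u v := Vtx.Arc m u v

theorem unlinked_isLoopless {m : ℕ} (hm : 0 < m) : (unlinked m).IsLoopless :=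
  fun _ h => Vtx.Arc.ne hm h rfl

instance (m : ℕ) : Finite {v // Vtx.IsValid m v} := (Vtx.finite_isValid m).to_subtype

theorem unlinked_isKStrong (l : ℕ) : (unlinked (l + 1)).IsKStrong l := by
  constructor
  · have : Function.Injective fun i : Fin (l + 1) =>
        (⟨.L (0, i), by simp, by simpa using i.2⟩ : {v // Vtx.IsValid (l + 1) v}) := by
      intro i j h
      simpa [Fin.ext_iff] using congrArg Subtype.val h
    simpa using Nat.card_le_card_of_injective _ this
  · intro X hX x y hx hy hxy
    set X' := X.map (Function.Embedding.subtype _) with hX'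
    have hmem : ∀ v : {v // Vtx.IsValid (l + 1) v}, v.1 ∈ X' ↔ v ∈ X := by
      intro v; simp [hX', v.2]
    have hr : Vtx.Reach (l + 1) X' x y :=
      Vtx.reach_of_alive (by rw [hX', Finset.card_map]; omega) ⟨x.2, by rwa [hmem]⟩
        ⟨y.2, by rwa [hmem]⟩
    have key : ∀ v, Vtx.Reach (l + 1) X' x v → ∀ hv : Vtx.IsValid (l + 1) v,
        Relation.ReflTransGen (fun a b => (unlinked (l + 1)).Adj a b ∧ b ∉ X) x ⟨v, hv⟩ := by
      intro v h
      induction h with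
      | refl => exact fun _ => .refl
      | tail _ h ih => exact fun hv => (ih h.2.1.1).tail ⟨h.1, by rw [← hmem]; exact h.2.2.2⟩
    obtain ⟨p, hc, hn, hh, hl⟩ := exists_nodup_chain (key y hr y.2)
    refine ⟨p, ⟨hc.imp fun _ _ h => h.1, hn, hh, hl⟩, ?_⟩
    rcases p with _ | ⟨z, p⟩
    · simp
    obtain rfl : z = x := by simpa using hh
    have : ∀ (q : List _) (z : {v // Vtx.IsValid (l + 1) v}), z ∉ X →
        (z :: q).IsChain (fun a b => (unlinked (l + 1)).Adj a b ∧ b ∉ X) →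
        ∀ w ∈ z :: q, w ∉ X := by
      intro q
      induction q with
      | nil => simp +contextual
      | cons z' q ih =>
        intro z hz hc w hw
        rw [List.isChain_cons_cons] at hc
        rcases List.mem_cons.1 hw with rfl | hw
        · exact hz
        · exact ih z' hc.1.2 hc.2 w hw
    exact this p z hx hc

/-! ### Joining with an arbitrary first part -/

/-- Two sets as the parts of a composition. -/
def twoParts (A B : Type) : Fin 2 → Type
  | 0 => A
  | 1 => B

def twoDigraphs {A B : Type} (G : Digraph A) (H : Digraph B) : ∀ i, Digraph (twoParts A B i)
  | 0 => G
  | 1 => H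

/-- The digraph with all arcs between distinct vertices. -/
def loopless (V : Type) : Digraph V where
  Adj u v := u ≠ v

/-- The disjoint union of two digraphs with all arcs between them. -/
abbrev join {A B : Type} (G : Digraph A) (H : Digraph B) : Digraph (Σ i, twoParts A B i) :=
  (loopless (Fin 2)).composition (twoDigraphs G H)

section Join

variable {A B : Type} {G : Digraph A} {H : Digraph B}

def inFst (a : A) : Σ i, twoParts A B i := ⟨0, a⟩

def inSnd (b : B) : Σ i, twoParts A B i := ⟨1, b⟩

theorem eq_inFst_or_eq_inSnd (v : Σ i, twoParts A B i) :
    (∃ a, v = inFst a) ∨ ∃ b, v = inSnd b := by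
  obtain ⟨i, v⟩ := v
  fin_cases i
  · exact Or.inl ⟨v, rfl⟩
  · exact Or.inr ⟨v, rfl⟩

theorem inFst_injective : Function.Injective (inFst : A → Σ i, twoParts A B i) :=
  fun _ _ h => eq_of_heq (Sigma.mk.inj h).2

theorem inSnd_injective : Function.Injective (inSnd : B → Σ i, twoParts A B i) :=
  fun _ _ h => eq_of_heq (Sigma.mk.inj h).2

theorem inFst_ne_inSnd (a : A) (b : B) : (inFst a : Σ i, twoParts A B i) ≠ inSnd b :=
  fun h => by simpa using (Sigma.mk.inj h).1

theorem join_adj_fst_snd (a : A) (b : B) : (join G H).Adj (inFst a) (inSnd b) :=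
  Or.inr (by simp [loopless, inFst, inSnd])

theorem join_adj_snd_fst (a : A) (b : B) : (join G H).Adj (inSnd b) (inFst a) :=
  Or.inr (by simp [loopless, inFst, inSnd])

theorem join_adj_snd {b b' : B} : (join G H).Adj (inSnd b) (inSnd b') ↔ H.Adj b b' := by
  constructor
  · rintro (⟨i, u, v, h, h', hadj⟩ | h)
    · obtain rfl : 1 = i := (Sigma.mk.inj h).1
      obtain rfl : b = u := eq_of_heq (Sigma.mk.inj h).2
      obtain rfl : b' = v := eq_of_heq (Sigma.mk.inj h').2
      exact hadj
    · exact absurd rfl h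
  · exact fun h => Or.inl ⟨1, b, b', rfl, rfl, h⟩

instance [Finite A] [Finite B] (i : Fin 2) : Finite (twoParts A B i) := by
  match i with
  | 0 => exact ‹Finite A›
  | 1 => exact ‹Finite B›

/-- Only two vertices of the first part need a detour, through a surviving vertex of the second,
which has at least `l + 1` vertices. -/
theorem join_isKStrong [Finite A] [Finite B] {l : ℕ} (hH : H.IsKStrong l) :
    (join G H).IsKStrong l := by
  classical
  refine ⟨hH.1.trans (Nat.card_le_card_of_injective _ inSnd_injective), ?_⟩
  intro X hX x y hx hy hxy
  set X' : Finset B := X.preimage inSnd inSnd_injective.injOn with hX'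
  have hmem : ∀ b, b ∈ X' ↔ inSnd b ∈ X := fun b => by simp [hX']
  have hcard : X'.card < l := lt_of_le_of_lt
    (Finset.card_le_card_of_injOn inSnd (fun b hb => (hmem b).1 hb) inSnd_injective.injOn) hX
  rcases eq_inFst_or_eq_inSnd x with ⟨a, rfl⟩ | ⟨b, rfl⟩ <;>
    rcases eq_inFst_or_eq_inSnd y with ⟨a', rfl⟩ | ⟨b', rfl⟩
  · obtain ⟨c, hc⟩ : ∃ c, c ∉ X' := by
      by_contra! h
      have := Fintype.ofFinite B
      have h1 := hH.1
      rw [Nat.card_eq_fintype_card, ← Finset.card_univ, ← Finset.eq_univ_of_forall h] at h1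
      omega
    rw [hmem] at hc
    refine ⟨[inFst a, inSnd c, inFst a'], ⟨?_, ?_, rfl, rfl⟩, ?_⟩
    · simp only [List.isChain_cons_cons, List.isChain_singleton, and_true]
      exact ⟨join_adj_fst_snd _ _, join_adj_snd_fst _ _⟩
    · simp [inFst_ne_inSnd, (inFst_ne_inSnd _ _).symm, hxy]
    · simp [hx, hc, hy]
  · refine ⟨[inFst a, inSnd b'], ⟨?_, ?_, rfl, rfl⟩, ?_⟩
    · simp only [List.isChain_cons_cons, List.isChain_singleton, and_true]
      exact join_adj_fst_snd _ _
    · simp [hxy]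
    · simp [hx, hy]
  · refine ⟨[inSnd b, inFst a'], ⟨?_, ?_, rfl, rfl⟩, ?_⟩
    · simp only [List.isChain_cons_cons, List.isChain_singleton, and_true]
      exact join_adj_snd_fst _ _
    · simp [hxy]
    · simp [hx, hy]
  · obtain ⟨p, ⟨hc, hn, hh, hl⟩, hp⟩ := hH.2 X' hcard b b' (by rwa [hmem]) (by rwa [hmem])
      (fun h => hxy (h ▸ rfl))
    refine ⟨p.map inSnd, ⟨?_, hn.map inSnd_injective, by simp [hh], by simp [hl]⟩, ?_⟩
    · rw [List.isChain_map]
      exact hc.imp fun _ _ h => join_adj_snd.2 h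
    · intro z hz
      obtain ⟨c, hc, rfl⟩ := List.mem_map.1 hz
      rw [← hmem]
      exact hp c hc

theorem exists_isDiPath_of_forall {x y : B} {P : List (Σ i, twoParts A B i)}
    (hP : (join G H).IsDiPath (inSnd x) (inSnd y) P) (h : ∀ a, inFst a ∉ P) :
    ∃ p, P = p.map inSnd ∧ H.IsDiPath x y p := by
  obtain ⟨p, rfl⟩ : ∃ p : List B, P = p.map inSnd := by
    clear hP
    induction P with
    | nil => exact ⟨[], rfl⟩
    | cons v P ih =>
      obtain ⟨p, rfl⟩ := ih fun a ha => h a (List.mem_cons_of_mem _ ha)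
      rcases eq_inFst_or_eq_inSnd v with ⟨a, rfl⟩ | ⟨b, rfl⟩
      · exact absurd (List.mem_cons_self) (h a)
      · exact ⟨b :: p, rfl⟩
  refine ⟨p, rfl, ?_, hP.2.1.of_map _, ?_, ?_⟩
  · have := hP.1
    rw [List.isChain_map] at this
    exact this.imp fun _ _ h => join_adj_snd.1 h
  · have := hP.2.2.1
    rw [List.head?_map, Option.map_eq_some_iff] at this
    obtain ⟨z, hz, hz'⟩ := this
    rw [hz, inSnd_injective hz']
  · have := hP.2.2.2
    rw [List.getLast?_map, Option.map_eq_some_iff] at this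
    obtain ⟨z, hz, hz'⟩ := this
    rw [hz, inSnd_injective hz']

end Join

/-! ### Terminals that block the first part -/

theorem unlinked_not_disjoint {m : ℕ} (hm : 0 < m) {P Q : List {v // Vtx.IsValid m v}}
    (hP : (unlinked m).IsDiPath ⟨.s false, trivial⟩ ⟨.t false, trivial⟩ P)
    (hQ : (unlinked m).IsDiPath ⟨.s true, trivial⟩ ⟨.t true, trivial⟩ Q) : ¬ P.Disjoint Q := by
  have lift : ∀ {x y} {P : List {v // Vtx.IsValid m v}}, (unlinked m).IsDiPath x y P →
      (P.map Subtype.val).IsChain (Vtx.Arc m) ∧ (P.map Subtype.val).Nodup ∧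
      (P.map Subtype.val).head? = some x.1 ∧ (P.map Subtype.val).getLast? = some y.1 ∧
      ∀ v ∈ P.map Subtype.val, Vtx.IsValid m v := by
    rintro x y P ⟨h1, h2, h3, h4⟩
    refine ⟨(List.isChain_map _).2 h1, h2.map Subtype.val_injective,
      by rw [List.head?_map, h3]; rfl, by rw [List.getLast?_map, h4]; rfl, ?_⟩
    intro v hv
    obtain ⟨w, -, rfl⟩ := List.mem_map.1 hv
    exact w.2
  obtain ⟨p1, p2, p3, p4, p5⟩ := lift hP
  obtain ⟨q1, q2, q3, q4, q5⟩ := lift hQ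
  intro h
  refine Vtx.not_disjoint_paths hm p1 p2 p3 p4 p5 q1 q2 q3 q4 q5 ?_
  intro v hv hv'
  obtain ⟨w, hw, rfl⟩ := List.mem_map.1 hv
  obtain ⟨w', hw', e⟩ := List.mem_map.1 hv'
  exact h hw (Subtype.ext e ▸ hw')

/-- The start (`b = false`) or end (`b = true`) of the `i`-th pair: the first two pairs are the
terminals of `unlinked m`, the others exhaust the part `Fin (2 * k - 4)`. -/
def terminal (m : ℕ) {k : ℕ} (b : Bool) (i : Fin k) :
    Σ j, twoParts (Fin (2 * k - 4)) {v // Vtx.IsValid m v} j :=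
  if h : 2 ≤ i.1 then inFst ⟨2 * (i - 2) + b.toNat, by have := b.toNat_lt; omega⟩
  else inSnd (if b then ⟨.t (i.1 == 1), trivial⟩ else ⟨.s (i.1 == 1), trivial⟩)

theorem terminal_injective (m k : ℕ) :
    Function.Injective (Sum.elim (terminal m (k := k) false) (terminal m true)) := by
  have key : ∀ (b c : Bool) (i j : Fin k), terminal m b i = terminal m c j → b = c ∧ i = j := by
    intro b c i j h
    unfold terminal at h
    split_ifs at h with h1 h2 h2 h2
    · have := inFst_injective h
      simp only [Fin.mk.injEq] at this
      rw [Fin.ext_iff]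
      cases b <;> cases c <;> simp at this ⊢ <;> omega
    all_goals first
      | exact absurd h (inFst_ne_inSnd _ _)
      | exact absurd h.symm (inFst_ne_inSnd _ _)
      | skip
    all_goals
      have := inSnd_injective h
      have hi : i.1 = 0 ∨ i.1 = 1 := by omega
      have hj : j.1 = 0 ∨ j.1 = 1 := by omega
      rw [Fin.ext_iff]
      rcases hi with hi | hi <;> rcases hj with hj | hj <;> simp_all
  rintro (i | i) (j | j) h
  · rw [(key _ _ _ _ h).2]
  · simpa using (key _ _ _ _ h).1
  · simpa using (key _ _ _ _ h).1
  · rw [(key _ _ _ _ h).2]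

theorem join_unlinked_not_isKLinked {m k : ℕ} (hm : 0 < m) (hk : 2 ≤ k)
    (G : Digraph (Fin (2 * k - 4))) : ¬ (join G (unlinked m)).IsKLinked k := by
  intro h
  obtain ⟨P, hP, hd⟩ := h _ _ (terminal_injective m k)
  have hout : ∀ i : Fin k, i.1 < 2 → ∀ a, inFst a ∉ P i := by
    intro i hi a ha
    let j : Fin k := ⟨a / 2 + 2, by have := a.2; omega⟩
    have hj : 2 ≤ j.1 := Nat.le_add_left _ _
    refine hd i j (fun h => by rw [h] at hi; omega) ha ?_
    -- Each vertex of the first part is a start or an end of pair `a / 2 + 2`, according to parity,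
    -- hence lies on that pair's path.
    rcases Nat.mod_two_eq_zero_or_one a with h0 | h0
    · have e : inFst a = terminal m false j := by
        rw [terminal, dif_pos hj]
        congr 1
        ext
        simp [j]
        omega
      rw [e]
      exact List.mem_of_mem_head? (hP j).2.2.1
    · have e : inFst a = terminal m true j := by
        rw [terminal, dif_pos hj]
        congr 1
        ext
        simp [j]
        omega
      rw [e]
      exact List.mem_of_getLast? (hP j).2.2.2
  obtain ⟨p, hp, hp'⟩ := exists_isDiPath_of_forall (hP ⟨0, by omega⟩) (hout _ (by simp))
  obtain ⟨q, hq, hq'⟩ := exists_isDiPath_of_forall (hP ⟨1, by omega⟩) (hout _ (by simp))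
  refine unlinked_not_disjoint hm hp' hq' fun v hv hv' => ?_
  refine hd ⟨0, by omega⟩ ⟨1, by omega⟩ (by simp) (a := inSnd v) ?_ ?_
  · rw [hp]; exact List.mem_map_of_mem hv
  · rw [hq]; exact List.mem_map_of_mem hv'

end Digraph

theorem proposition6p2 (k : ℕ) (hk : 3 ≤ k) (l : ℕ) :
    ∃ (r : ℕ) (hr : 2 ≤ r) (R : Digraph (Fin r)) (V : Fin r → Type) (S : ∀ i, Digraph (V i)),
      R.IsLoopless ∧ R.IsSemicomplete ∧
      (∀ i, Finite (V i) ∧ Nonempty (V i) ∧ (S i).IsLoopless) ∧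
      {a : Σ i, V i | a.1 ≠ ⟨r - 1, by omega⟩}.ncard ≤ 2 * k - 4 ∧
      (R.composition S).IsKStrong l ∧
      ¬ (R.composition S).IsKLinked k := by
  let G : Digraph (Fin (2 * k - 4)) := ⟨fun _ _ => False⟩
  -- The value `m = l + 1` keeps `m` positive when `l = 0`.
  refine ⟨2, le_rfl, Digraph.loopless (Fin 2), _, Digraph.twoDigraphs G (Digraph.unlinked (l + 1)),
    fun v h => h rfl, fun u v h => Or.inl h, fun i => ⟨inferInstance, ?_⟩, ?_,
    Digraph.join_isKStrong (Digraph.unlinked_isKStrong l),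
    Digraph.join_unlinked_not_isKLinked (by omega) (by omega) G⟩
  · match i with
    -- Here `k ≥ 3` is needed: for `k = 2` the first part would be empty.
    | 0 => exact ⟨⟨(⟨0, by omega⟩ : Fin (2 * k - 4))⟩, fun _ h => h⟩
    | 1 => exact ⟨⟨(⟨.s false, trivial⟩ : {v // Digraph.Vtx.IsValid (l + 1) v})⟩,
        Digraph.unlinked_isLoopless (by omega)⟩
  · have hsub : {a : Σ i, Digraph.twoParts (Fin (2 * k - 4))
        {v // Digraph.Vtx.IsValid (l + 1) v} i | a.1 ≠ ⟨2 - 1, by omega⟩} ⊆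
        Set.range Digraph.inFst := by
      intro v hv
      rcases Digraph.eq_inFst_or_eq_inSnd v with ⟨a, rfl⟩ | ⟨b, rfl⟩
      · exact ⟨a, rfl⟩
      · exact absurd rfl hv
    refine (Set.ncard_le_ncard hsub (Set.finite_range _)).trans ?_
    rw [← Set.image_univ]
    refine (Set.ncard_image_le Set.finite_univ).trans ?_
    simp [Set.ncard_univ]
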